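/- Let $(M,g)$ be a smooth Riemannian manifold (without boundary, second countable) of dimension $n\ge 1$, and let $\mu$ be a Borel probability measure on $M$ that is absolutely continuous with respect to the Riemannian volume measure. For $A\subset\Omega\subset M$ put $$\mathrm{Cap}_\mu(A,\Omega)=\inf\Big\{\int|\nabla f|^2\,d\mu \;:\; f:M\to\mathbb R \text{ locally Lipschitz},\ f\ge 1 \text{ on } A,\ f=0 \text{ on } \Omega^c\Big\}$$ (with $\inf\emptyset=+\infty$; here $\nabla f$ is the gradient of $f$, which exists $\mu$-almost everywhere by Rademacher's theorem), and, for $\mu(A)<1/2$, $$\mathrm{Cap}_\mu(A)=\inf\{\mathrm{Cap}_\mu(A,\Omega) \;:\; \Omega \text{ measurable},\ A\subset\Omega,\ \mu(\Omega)\le 1/2\}.$$ Let $\beta:[1,\infty)\to(0,\infty)$ be non-increasing and such that $s\mapsto s\beta(s)$ is non-decreasing on $[2,\infty)$. Then for every $a\in(0,1/2)$ $$\frac12\,\frac{a}{\beta(1/a)}\;\le\;\sup_{s\ge1}\frac{a}{1+(s-1)a}\,\frac1{\beta(s)}\;\le\;2\,\frac{a}{\beta(1/a)}$$ (in particular the supremum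 is finite). Moreover, if every measurable $A\subset M$ with $\mu(A)<1/2$ satisfies $$\mathrm{Cap}_\mu(A)\ge\frac{\mu(A)}{\beta(1/\mu(A))}$$ (the right-hand side being read as $0$ when $\mu(A)=0$), then for every locally Lipschitz $f:M\to\mathbb R$ (in particular every smooth $f$) and every $s\ge1$ $$\int f^2\,d\mu\;\le\; s\Big(\int|f|\,d\mu\Big)^2+8\beta(s)\int|\nabla f|^2\,d\mu,$$ as an inequality in $[0,+\infty]$; that is, $\int f^2\,d\mu-s\left(\int|f|\,d\mu\right)^2\le 8\beta(s)\int|\nabla f|^2\,d\mu$. -/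

import Mathlib

open MeasureTheory Bundle
open scoped Manifold ContDiff Bundle ENNReal

noncomputable section

namespace SuperPoincare

variable (n : ℕ) {M : Type*} [EMetricSpace M] [ChartedSpace (EuclideanSpace ℝ (Fin n)) M]
  [RiemannianBundle (fun x : M ↦ TangentSpace (𝓡 n) x)]

/-- The coordinate vector field `∂_i` of the chart at `p`, as a tangent vector of `M` at the point
with coordinates `y`. -/
def coordVector (p : M) (y : EuclideanSpace ℝ (Fin n)) (i : Fin n) :
    TangentSpace (𝓡 n) ((chartAt (EuclideanSpace ℝ (Fin n)) p).symm y) :=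
  mfderiv (𝓡 n) (𝓡 n) (chartAt (EuclideanSpace ℝ (Fin n)) p).symm y
    (EuclideanSpace.single i (1 : ℝ))

/-- The matrix `g_ij = ⟨∂_i, ∂_j⟩` of the Riemannian metric in the chart at `p`. -/
def metricMatrix (p : M) (y : EuclideanSpace ℝ (Fin n)) : Matrix (Fin n) (Fin n) ℝ :=
  Matrix.of fun i j ↦ inner ℝ (coordVector n p y i) (coordVector n p y j)

/-- Tangent spaces, with their Riemannian norms, are complete since they are finite-dimensional. -/
theorem completeSpace_tangentSpace (x : M) : CompleteSpace (TangentSpace (𝓡 n) x) :=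
  haveI : FiniteDimensional ℝ (TangentSpace (𝓡 n) x) :=
    inferInstanceAs (FiniteDimensional ℝ (EuclideanSpace ℝ (Fin n)))
  FiniteDimensional.complete ℝ (TangentSpace (𝓡 n) x)

/-- The Riemannian gradient `∇f`: the tangent vector representing the differential of `f`
(it is zero by convention where `f` is not differentiable). -/
def riemannianGradient (f : M → ℝ) (x : M) : TangentSpace (𝓡 n) x :=
  haveI := completeSpace_tangentSpace n x
  (InnerProductSpace.toDual ℝ (TangentSpace (𝓡 n) x)).symm (mfderiv (𝓡 n) 𝓘(ℝ, ℝ) f x)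

variable [MeasurableSpace M]

/-- The Riemannian volume restricted to the domain of the chart at `p`: the image of the measure
`√(det g_ij) dy` on the chart's target under the inverse of the chart. -/
def chartVolume (p : M) : Measure M :=
  ((volume.restrict (chartAt (EuclideanSpace ℝ (Fin n)) p).target).withDensity
    (fun y ↦ ENNReal.ofReal (Real.sqrt (metricMatrix n p y).det))).map
      (chartAt (EuclideanSpace ℝ (Fin n)) p).symm

/-- The Riemannian volume measure of `M`. The measures `chartVolume n p` are restrictions to the
chart domains of one and the same measure (by the change of variables formula); since the chart
domains cover `M`, their supremum in the lattice of measures is that measure. -/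
def riemannianVolume : Measure M := ⨆ p : M, chartVolume n p

/-- The energy `∫ |∇f|² dμ`, possibly infinite. -/
def energy (μ : Measure M) (f : M → ℝ) : ℝ≥0∞ := ∫⁻ x, ‖riemannianGradient n f x‖ₑ ^ 2 ∂μ

/-- The capacity `Cap_μ(A, Ω)`; it is `∞` if there is no admissible function. -/
def relCapacity (μ : Measure M) (A Ω : Set M) : ℝ≥0∞ :=
  sInf {e | ∃ f : M → ℝ, LocallyLipschitz f ∧ (∀ x ∈ A, 1 ≤ f x) ∧ (∀ x ∈ Ωᶜ, f x = 0) ∧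
    e = energy n μ f}

/-- The capacity `Cap_μ(A)`. -/
def capacity (μ : Measure M) (A : Set M) : ℝ≥0∞ :=
  sInf {c | ∃ Ω : Set M, MeasurableSet Ω ∧ A ⊆ Ω ∧ μ Ω ≤ 1 / 2 ∧ c = relCapacity n μ A Ω}

end SuperPoincare

end

/-! The rate comparison turns the capacity hypothesis into a/(1 + (s-1)a) ≤ 2β(s) · energy(u), with
a = μ(A), for every u admissible for (A, Ω) (`measure_le_energy_of_capacity`).

Take bounded h ≥ 0 with μ(h > 0) ≤ 1/2 and put K = s - 1, I = ∫ h dμ. For u = min((h/t)², 1), A = {h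
≥ t}, Ω = {h > 0}, integrate this bound against 2t dt. The energies add up to at most 4 ∫ |∇h|². On
the other side a/(1 + Ka) dominates ν(A), where ν = (1 - KI/h)₊ μ, and ∫ h² dν ≥ ∫ h² dμ - K I².
Hence ∫ h² ≤ (s-1)(∫ h)² + 8β(s) ∫ |∇h|² (`lintegral_sq_le_of_superlevel`).

A bounded f ≥ 0 is split at a median m into (f - m)₊ and (m - f)₊, both of small support. Passing
from s - 1 to s pays for recombining them (`integral_sq_le_of_median`). General f follows by
monotone convergence along min(|f|, N).

Gradient bounds are pointwise everywhere: the gradient is 0 at points of non-differentiability and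
at local extrema, so Rademacher's theorem is not needed. Nor is measurability of |∇f|: the integrals
are lower integrals. -/

namespace SuperPoincare

open Filter Topology Set

/-! ### Gradients at extrema and under composition -/

section Gradient

variable (n : ℕ) {M : Type*} [EMetricSpace M] [ChartedSpace (EuclideanSpace ℝ (Fin n)) M]

/-- The differential of a real function, as a linear form on the tangent space. -/
noncomputable def differential (f : M → ℝ) (x : M) : TangentSpace (𝓡 n) x →L[ℝ] ℝ :=
  mfderiv (𝓡 n) 𝓘(ℝ, ℝ) f x

/-- Needs no differentiability, since the derivative defaults to 0. It covers the kinks and flat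
pieces of every truncation below, as these are local extrema. -/
theorem mfderiv_eq_zero_of_isLocalExtr {u : M → ℝ} {x : M} (h : IsLocalExtr u x) :
    mfderiv (𝓡 n) 𝓘(ℝ, ℝ) u x = 0 := by
  by_cases hd : MDifferentiableAt (𝓡 n) 𝓘(ℝ, ℝ) u x
  · rw [hd.mfderiv, ModelWithCorners.range_eq_univ, fderivWithin_univ]
    apply IsLocalExtr.fderiv_eq_zero
    have hc : ContinuousAt (extChartAt (𝓡 n) x).symm (extChartAt (𝓡 n) x x) :=
      continuousAt_extChartAt_symm x
    have hx : (extChartAt (𝓡 n) x).symm (extChartAt (𝓡 n) x x) = x :=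
      extChartAt_to_inv x
    have hc' : Tendsto (extChartAt (𝓡 n) x).symm (𝓝 (extChartAt (𝓡 n) x x)) (𝓝 x) := by
      have := hc.tendsto; rwa [hx] at this
    rw [← hx] at h
    exact IsExtrFilter.comp_tendsto (g := (extChartAt (𝓡 n) x).symm) h (by rw [hx]; exact hc')
  · exact mfderiv_zero_of_not_mdifferentiableAt hd

variable [RiemannianBundle (fun x : M ↦ TangentSpace (𝓡 n) x)]

theorem riemannianGradient_eq_of_differential_eq_smul {f u : M → ℝ} {x : M} (c : ℝ)
    (h : differential n u x = c • differential n f x) :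
    riemannianGradient n u x = c • riemannianGradient n f x := by
  have := completeSpace_tangentSpace n x
  have key : ∀ w : M → ℝ, riemannianGradient n w x =
    (InnerProductSpace.toDual ℝ (TangentSpace (𝓡 n) x)).symm (differential n w x) := fun _ ↦ rfl
  rw [key, key, h]
  simp

theorem riemannianGradient_eq_zero_of_mfderiv {u : M → ℝ} {x : M}
    (h : mfderiv (𝓡 n) 𝓘(ℝ, ℝ) u x = 0) : riemannianGradient n u x = 0 := by
  have := riemannianGradient_eq_of_differential_eq_smul n (f := u) (u := u) (x := x) 0
    (by rw [zero_smul]; exact h)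
  rwa [zero_smul] at this

theorem riemannianGradient_eq_zero_of_isLocalExtr {u : M → ℝ} {x : M} (h : IsLocalExtr u x) :
    riemannianGradient n u x = 0 :=
  riemannianGradient_eq_zero_of_mfderiv n (mfderiv_eq_zero_of_isLocalExtr n h)

/-- Chain rule for the gradient. It holds also where `f` is not differentiable, since then the
composition is not differentiable either. -/
theorem riemannianGradient_comp {f u : M → ℝ} {x : M} {φ : ℝ → ℝ} {c : ℝ}
    (hf : ContinuousAt f x) (hφ : HasStrictDerivAt φ c (f x)) (hc : c ≠ 0)
    (hu : u =ᶠ[𝓝 x] φ ∘ f) :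
    riemannianGradient n u x = c • riemannianGradient n f x := by
  by_cases hd : MDifferentiableAt (𝓡 n) 𝓘(ℝ, ℝ) f x
  · apply riemannianGradient_eq_of_differential_eq_smul
    ext v
    have h := (HasMFDerivAt.comp x
      (hφ.hasDerivAt.hasFDerivAt.hasMFDerivAt : HasMFDerivAt 𝓘(ℝ, ℝ) 𝓘(ℝ, ℝ) φ (f x) _)
      hd.hasMFDerivAt).mfderiv
    have h' := hu.mfderiv_eq (I := 𝓡 n) (I' := 𝓘(ℝ, ℝ))
    have h3 := congrArg (fun L : TangentSpace (𝓡 n) x →L[ℝ] ℝ ↦ L v) (h'.trans h)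
    refine h3.trans (mul_comm _ _)
  · have hu' : ¬ MDifferentiableAt (𝓡 n) 𝓘(ℝ, ℝ) u x := by
      intro h
      apply hd
      have hux : u x = φ (f x) := hu.eq_of_nhds
      -- As c ≠ 0, φ has a differentiable local inverse, through which differentiability of u would
      -- pass to f.
      have h1 := (hφ.to_localInverse hc).hasDerivAt.differentiableAt
      rw [← hux] at h1
      refine (h1.mdifferentiableAt.comp x h).congr_of_eventuallyEq ?_
      have h2 := hf.eventually (hφ.eventually_left_inverse hc)
      filter_upwards [h2, hu] with y hy huy
      simp only [Function.comp_apply, huy]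
      exact hy.symm
    rw [riemannianGradient_eq_zero_of_mfderiv n (mfderiv_zero_of_not_mdifferentiableAt hu'),
      riemannianGradient_eq_zero_of_mfderiv n (mfderiv_zero_of_not_mdifferentiableAt hd), smul_zero]

end Gradient

/-! ### Pointwise gradient bounds for truncations -/

section Truncation

variable (n : ℕ) {M : Type*} [EMetricSpace M] [ChartedSpace (EuclideanSpace ℝ (Fin n)) M]
  [RiemannianBundle (fun x : M ↦ TangentSpace (𝓡 n) x)]

theorem enorm_gradient_min_abs_le {f : M → ℝ} (hf : Continuous f) {N : ℝ} (hN : 0 < N) (x : M) :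
    ‖riemannianGradient n (fun y ↦ min |f y| N) x‖ₑ ≤ ‖riemannianGradient n f x‖ₑ := by
  rcases le_or_gt N |f x| with h | h
  · rw [riemannianGradient_eq_zero_of_isLocalExtr n (Or.inr ?_)]
    · simp
    · exact Eventually.of_forall fun y ↦ by simp [min_eq_right h]
  rcases lt_trichotomy (f x) 0 with h0 | h0 | h0
  · have hev : (fun y ↦ min |f y| N) =ᶠ[𝓝 x] (fun s : ℝ ↦ -s) ∘ f := by
      filter_upwards [hf.continuousAt.eventually_lt_const h0,
        hf.abs.continuousAt.eventually_lt_const h] with y h1 h2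
      rw [abs_of_neg h1] at h2
      simp [abs_of_neg h1, h2.le]
    rw [riemannianGradient_comp n hf.continuousAt (hasStrictDerivAt_neg (f x)) (by simp) hev]
    simp
  · rw [riemannianGradient_eq_zero_of_isLocalExtr n (Or.inl ?_)]
    · simp
    · exact Eventually.of_forall fun y ↦ by simp [h0, hN.le]
  · have hev : (fun y ↦ min |f y| N) =ᶠ[𝓝 x] (fun s : ℝ ↦ s) ∘ f := by
      filter_upwards [hf.continuousAt.eventually_const_lt h0,
        hf.abs.continuousAt.eventually_lt_const h] with y h1 h2
      rw [abs_of_pos h1] at h2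
      simp [abs_of_pos h1, h2.le]
    rw [riemannianGradient_comp n hf.continuousAt (hasStrictDerivAt_id (f x)) (by simp) hev]
    simp

theorem gradient_posPart_of_pos {f : M → ℝ} (hf : Continuous f) {m : ℝ} {x : M} (h : m < f x) :
    riemannianGradient n (fun y ↦ max (f y - m) 0) x = riemannianGradient n f x := by
  have hev : (fun y ↦ max (f y - m) 0) =ᶠ[𝓝 x] (fun s : ℝ ↦ s - m) ∘ f := by
    filter_upwards [hf.continuousAt.eventually_const_lt h] with y h1
    simp [h1.le]
  rw [riemannianGradient_comp n hf.continuousAt ((hasStrictDerivAt_id (f x)).sub_const m)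
    (by simp) hev]
  simp

theorem gradient_negPart_of_lt {f : M → ℝ} (hf : Continuous f) {m : ℝ} {x : M} (h : f x < m) :
    riemannianGradient n (fun y ↦ max (m - f y) 0) x = -riemannianGradient n f x := by
  have hev : (fun y ↦ max (m - f y) 0) =ᶠ[𝓝 x] (fun s : ℝ ↦ m - s) ∘ f := by
    filter_upwards [hf.continuousAt.eventually_lt_const h] with y h1
    simp [h1.le]
  rw [riemannianGradient_comp n hf.continuousAt ((hasStrictDerivAt_id (f x)).const_sub m)
    (by simp) hev]
  simp

theorem gradient_max_zero_of_nonpos {v : M → ℝ} {x : M} (h : v x ≤ 0) :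
    riemannianGradient n (fun y ↦ max (v y) 0) x = 0 :=
  riemannianGradient_eq_zero_of_isLocalExtr n
    (Or.inl (Eventually.of_forall fun y ↦ by simp [h]))

/-- Off {f = m} only one part has a nonzero gradient; on {f = m} both parts attain their minimum 0.
-/
theorem enorm_gradient_posPart_add_negPart_le {f : M → ℝ} (hf : Continuous f) (m : ℝ) (x : M) :
    ‖riemannianGradient n (fun y ↦ max (f y - m) 0) x‖ₑ ^ 2 +
      ‖riemannianGradient n (fun y ↦ max (m - f y) 0) x‖ₑ ^ 2 ≤
      ‖riemannianGradient n f x‖ₑ ^ 2 := by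
  rcases lt_trichotomy (f x) m with h | h | h
  · rw [gradient_max_zero_of_nonpos n (v := fun y ↦ f y - m) (by simpa using h.le),
      gradient_negPart_of_lt n hf h]
    simp
  · rw [gradient_max_zero_of_nonpos n (v := fun y ↦ f y - m) (by simp [h]),
      gradient_max_zero_of_nonpos n (v := fun y ↦ m - f y) (by simp [h])]
    simp
  · rw [gradient_max_zero_of_nonpos n (v := fun y ↦ m - f y) (by simpa using h.le),
      gradient_posPart_of_pos n hf h]
    simp

/-- The squared derivative of the cut-off `τ ↦ min ((τ / t) ^ 2) 1`. -/
noncomputable def cutoffWeight (t τ : ℝ) : ℝ := if τ < t then 4 * τ ^ 2 / t ^ 4 else 0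

theorem measurable_cutoffWeight : Measurable (Function.uncurry cutoffWeight) := by
  unfold Function.uncurry cutoffWeight
  refine Measurable.ite (measurableSet_lt measurable_snd measurable_fst) ?_ measurable_const
  fun_prop

/-- The square matters: the linear cut-off min(h/t, 1) has weight t⁻² on {h < t}, which against 2t
dt diverges logarithmically at infinity. -/
theorem enorm_gradient_cutoff_le {h : M → ℝ} (hc : Continuous h) (h0 : ∀ y, 0 ≤ h y) {t : ℝ}
    (ht : 0 < t) (x : M) :
    ‖riemannianGradient n (fun y ↦ min ((h y / t) ^ 2) 1) x‖ₑ ^ 2 ≤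
      ENNReal.ofReal (cutoffWeight t (h x)) * ‖riemannianGradient n h x‖ₑ ^ 2 := by
  rcases le_or_gt t (h x) with hx | hx
  · rw [riemannianGradient_eq_zero_of_isLocalExtr n (Or.inr ?_)]
    · simp
    · refine Eventually.of_forall fun y ↦ ?_
      have : 1 ≤ (h x / t) ^ 2 := one_le_pow₀ ((one_le_div ht).2 hx)
      simp [min_eq_right this]
  rcases (h0 x).eq_or_lt with hx0 | hx0
  · rw [riemannianGradient_eq_zero_of_isLocalExtr n (Or.inl ?_)]
    · simp
    · refine Eventually.of_forall fun y ↦ ?_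
      have hy : 0 ≤ min ((h y / t) ^ 2) 1 := by positivity
      simpa [← hx0] using hy
  · have hev : (fun y ↦ min ((h y / t) ^ 2) 1) =ᶠ[𝓝 x] (fun s : ℝ ↦ (s / t) ^ 2) ∘ h := by
      filter_upwards [hc.continuousAt.eventually_lt_const hx] with y h1
      refine min_eq_left ?_
      exact pow_le_one₀ (div_nonneg (h0 y) ht.le) ((div_le_one ht).2 h1.le)
    have hd : HasStrictDerivAt (fun s : ℝ ↦ (s / t) ^ 2) (2 * h x / t ^ 2) (h x) := by
      have := ((hasStrictDerivAt_id (h x)).div_const t).pow 2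
      refine this.congr_deriv ?_
      simp only [id_eq, Nat.cast_ofNat, Nat.add_one_sub_one, pow_one]
      field_simp
    rw [riemannianGradient_comp n hc.continuousAt hd (by positivity) hev, enorm_smul, mul_pow]
    gcongr
    rw [Real.enorm_eq_ofReal (by positivity), ← ENNReal.ofReal_pow (by positivity), cutoffWeight,
      if_pos hx]
    apply ENNReal.ofReal_le_ofReal
    apply le_of_eq
    field_simp
    ring

end Truncation

/-! ### Comparison of the two rate functions -/

section Rate

variable {β : ℝ → ℝ}

/-- For s ≤ 1/a use that β decreases and the denominator is at least 1. For s ≥ 1/a, monotonicity of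
sβ(s) gives β(1/a) ≤ saβ(s), and sa ≤ 2(1 + (s-1)a). -/
theorem rate_le_two_mul (hβ_pos : ∀ s, 1 ≤ s → 0 < β s) (hβ_anti : AntitoneOn β (Ici 1))
    (hβ_mono : MonotoneOn (fun s ↦ s * β s) (Ici 2)) {a : ℝ} (ha : 0 < a) (ha2 : a < 1 / 2)
    {s : ℝ} (hs : 1 ≤ s) : a / (1 + (s - 1) * a) * (1 / β s) ≤ 2 * (a / β (1 / a)) := by
  have h2 : 2 ≤ 1 / a := by rw [le_div_iff₀ ha]; linarith
  have hb := hβ_pos (1 / a) (by linarith)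
  have hs' := hβ_pos s hs
  have hD : 1 ≤ 1 + (s - 1) * a := by nlinarith
  rw [div_mul_div_comm, ← mul_div_assoc, div_le_div_iff₀ (by positivity) hb]
  rcases le_total s (1 / a) with h | h
  · have h1 : β (1 / a) ≤ β s := hβ_anti hs (by simp only [mem_Ici]; linarith) h
    calc a * 1 * β (1 / a) ≤ a * 1 * β s := by gcongr
      _ ≤ a * (2 * (1 + (s - 1) * a)) * β s := by gcongr; linarith
      _ = _ := by ring
  · have h1 : 1 / a * β (1 / a) ≤ s * β s := hβ_mono h2 (h2.trans h) h
    have h3 : β (1 / a) ≤ s * a * β s := by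
      calc β (1 / a) = a * (1 / a * β (1 / a)) := by field_simp
        _ ≤ a * (s * β s) := by gcongr
        _ = _ := by ring
    have h4 : s * a ≤ 2 * (1 + (s - 1) * a) := by nlinarith [mul_pos (by linarith : 0 < s) ha]
    calc a * 1 * β (1 / a) ≤ a * 1 * (s * a * β s) := by gcongr
      _ = a * (s * a) * β s := by ring
      _ ≤ a * (2 * (1 + (s - 1) * a)) * β s :=
        mul_le_mul_of_nonneg_right (mul_le_mul_of_nonneg_left h4 ha.le) hs'.le
      _ = _ := by ring

end Rate

/-! ### Absence of atoms -/

section Atoms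

variable (n : ℕ) {M : Type*} [EMetricSpace M] [ChartedSpace (EuclideanSpace ℝ (Fin n)) M]
  [RiemannianBundle (fun x : M ↦ TangentSpace (𝓡 n) x)] [MeasurableSpace M] [BorelSpace M]

theorem chartVolume_singleton (hn : 1 ≤ n) (p x : M) : chartVolume n p {x} = 0 := by
  unfold chartVolume
  set e := chartAt (EuclideanSpace ℝ (Fin n)) p
  set ν := ((volume.restrict e.target).withDensity
    (fun y ↦ ENNReal.ofReal (Real.sqrt (metricMatrix n p y).det)))
  by_cases hm : AEMeasurable e.symm ν
  swap
  · rw [Measure.map_of_not_aemeasurable hm]; rfl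
  rw [Measure.map_apply_of_aemeasurable hm (measurableSet_singleton x)]
  refine withDensity_absolutelyContinuous _ _ ?_
  rw [Measure.restrict_apply' e.open_target.measurableSet]
  have : Nonempty (Fin n) := ⟨⟨0, hn⟩⟩
  have : Nontrivial (EuclideanSpace ℝ (Fin n)) := inferInstance
  refine measure_mono_null (t := {e x}) ?_ (measure_singleton _)
  rintro y ⟨hy, hyt⟩
  rw [mem_preimage, mem_singleton_iff] at hy
  rw [mem_singleton_iff, ← hy, e.right_inv hyt]

theorem riemannianVolume_singleton (hn : 1 ≤ n) (x : M) :
    riemannianVolume n ({x} : Set M) = 0 := by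
  -- A supremum of measures is not computed set by set, so it is bounded by the largest measure that
  -- does not charge x.
  have h : riemannianVolume n ≤ (⊤ : Measure M).restrict {x}ᶜ := by
    refine iSup_le fun p ↦ ?_
    have h0 : chartVolume n p = (chartVolume n p).restrict {x}ᶜ := by
      refine (Measure.restrict_eq_self_of_ae_mem ?_).symm
      rw [ae_iff]
      simpa using chartVolume_singleton n hn p x
    rw [h0]
    exact Measure.restrict_mono subset_rfl le_top
  refine le_antisymm ((h _).trans ?_) zero_le
  rw [Measure.restrict_apply (measurableSet_singleton x)]
  simp

end Atoms

/-- In a measure without atoms, every set of positive measure can be shrunk by an arbitrarily small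
positive amount. -/
theorem exists_seq_subset_measure_lt {M : Type*} [EMetricSpace M] [SecondCountableTopology M]
    [MeasurableSpace M] [BorelSpace M] {μ : Measure M} [IsFiniteMeasure μ] [NullSingletonClass μ]
    {A : Set M} (hA : MeasurableSet A) (h0 : μ A ≠ 0) :
    ∃ B : ℕ → Set M, (∀ k, MeasurableSet (B k)) ∧ (∀ k, B k ⊆ A) ∧ (∀ k, μ (B k) < μ A) ∧
      Tendsto (fun k ↦ μ (B k)) atTop (𝓝 (μ A)) := by
  -- Every ball around this x meets A in positive measure; removing shrinking balls loses only {x}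
  -- in the limit.
  obtain ⟨x, -, hx⟩ := exists_mem_forall_mem_nhdsWithin_pos_measure h0
  have hr : ∀ k : ℕ, (0 : ℝ≥0∞) < ((k : ℝ≥0∞) + 1)⁻¹ := fun k ↦ by simp
  let U : ℕ → Set M := fun k ↦ Metric.eball x ((k : ℝ≥0∞) + 1)⁻¹
  have hUm : ∀ k, MeasurableSet (U k) := fun k ↦ Metric.isOpen_eball.measurableSet
  have hanti : Antitone U := fun i j hij ↦ by
    apply Metric.eball_subset_eball
    gcongr
  refine ⟨fun k ↦ A \ U k, fun k ↦ hA.diff (hUm k), fun k ↦ sdiff_subset, fun k ↦ ?_, ?_⟩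
  · have hpos : 0 < μ (A ∩ U k) := hx _ (inter_mem_nhdsWithin _ (Metric.eball_mem_nhds x (hr k)))
    rw [← measure_inter_add_sdiff A (hUm k), add_comm]
    exact ENNReal.lt_add_right (measure_ne_top _ _) hpos.ne'
  · have hmono : Monotone fun k ↦ A \ U k := fun i j hij ↦ sdiff_subset_sdiff_right (hanti hij)
    have h := tendsto_measure_iUnion_atTop (μ := μ) hmono
    have hU : ⋃ k, A \ U k = A \ {x} := by
      rw [← sdiff_iInter]
      congr 1
      ext y
      simp only [mem_iInter, mem_singleton_iff]
      constructor
      · intro hy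
        by_contra hne
        have hd : edist y x ≠ 0 := by simpa using hne
        obtain ⟨k, hk⟩ := ENNReal.exists_inv_nat_lt hd
        have h1 : edist y x < ((k : ℝ≥0∞) + 1)⁻¹ := hy k
        have h2 : ((k : ℝ≥0∞) + 1)⁻¹ ≤ (k : ℝ≥0∞)⁻¹ := ENNReal.inv_le_inv.2 le_self_add
        exact absurd (h1.trans_le h2) hk.not_gt
      · rintro rfl k
        exact Metric.mem_eball_self (hr k)
    rw [hU, measure_sdiff_null (measure_singleton x)] at h
    exact h

/-! ### From capacities to energies of test functions -/

section Capacity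

variable (n : ℕ) {M : Type*} [EMetricSpace M] [ChartedSpace (EuclideanSpace ℝ (Fin n)) M]
  [RiemannianBundle (fun x : M ↦ TangentSpace (𝓡 n) x)] [MeasurableSpace M]

theorem capacity_le_energy {μ : Measure M} {A Ω : Set M} (hΩ : MeasurableSet Ω) (hAΩ : A ⊆ Ω)
    (hμΩ : μ Ω ≤ 1 / 2) {u : M → ℝ} (hu : LocallyLipschitz u) (h1 : ∀ x ∈ A, 1 ≤ u x)
    (h0 : ∀ x ∈ Ωᶜ, u x = 0) : capacity n μ A ≤ energy n μ u :=
  (show capacity n μ A ≤ relCapacity n μ A Ω from sInf_le ⟨Ω, hΩ, hAΩ, hμΩ, rfl⟩).trans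
    (sInf_le ⟨u, hu, h1, h0, rfl⟩)

/-- The lower bound on energies that a capacity inequality gives. Sets of measure exactly `1 / 2`
are reached by exhausting them from inside. -/
theorem measure_le_energy_of_capacity [BorelSpace M] [SecondCountableTopology M] {μ : Measure M}
    [IsProbabilityMeasure μ] [NullSingletonClass μ] {β : ℝ → ℝ} (hβ_pos : ∀ s, 1 ≤ s → 0 < β s)
    (hβ_anti : AntitoneOn β (Ici 1)) (hβ_mono : MonotoneOn (fun s ↦ s * β s) (Ici 2))
    (hcap : ∀ A : Set M, MeasurableSet A → μ A < 1 / 2 →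
      ENNReal.ofReal (μ.real A / β (1 / μ.real A)) ≤ capacity n μ A)
    {A Ω : Set M} (hA : MeasurableSet A) (hΩ : MeasurableSet Ω) (hAΩ : A ⊆ Ω)
    (hμΩ : μ Ω ≤ 1 / 2) {u : M → ℝ} (hu : LocallyLipschitz u) (h1 : ∀ x ∈ A, 1 ≤ u x)
    (h0 : ∀ x ∈ Ωᶜ, u x = 0) {s : ℝ} (hs : 1 ≤ s) :
    ENNReal.ofReal (μ.real A / (1 + (s - 1) * μ.real A)) ≤
      ENNReal.ofReal (2 * β s) * energy n μ u := by
  have hβs := hβ_pos s hs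
  have strict : ∀ B : Set M, MeasurableSet B → B ⊆ A → μ B < 1 / 2 →
      ENNReal.ofReal (μ.real B / (1 + (s - 1) * μ.real B)) ≤
        ENNReal.ofReal (2 * β s) * energy n μ u := by
    intro B hB hBA hμB
    have hle := (hcap B hB hμB).trans
      (capacity_le_energy n hΩ (hBA.trans hAΩ) hμΩ hu (fun x hx ↦ h1 x (hBA hx)) h0)
    rcases (measureReal_nonneg (μ := μ) (s := B)).eq_or_lt with hz | hz
    · simp [← hz]
    have hlt : μ.real B < 1 / 2 := by
      have := (ENNReal.toReal_lt_toReal (measure_ne_top μ B) (by simp)).2 hμB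
      simpa [Measure.real] using this
    refine le_trans ?_ (mul_le_mul_right hle _)
    rw [← ENNReal.ofReal_mul (by positivity)]
    apply ENNReal.ofReal_le_ofReal
    have := rate_le_two_mul hβ_pos hβ_anti hβ_mono hz hlt hs
    rw [mul_one_div, div_le_iff₀ hβs] at this
    linarith
  have hμA : μ A ≤ 1 / 2 := (measure_mono hAΩ).trans hμΩ
  rcases hμA.lt_or_eq with hlt | heq
  · exact strict A hA subset_rfl hlt
  have hne : μ A ≠ 0 := by rw [heq]; simp
  obtain ⟨B, hBm, hBA, hBlt, hB⟩ := exists_seq_subset_measure_lt hA hne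
  have hreal : Tendsto (fun k ↦ μ.real (B k)) atTop (𝓝 (μ.real A)) :=
    (ENNReal.tendsto_toReal (measure_ne_top μ A)).comp hB
  have hD : 1 + (s - 1) * μ.real A ≠ 0 := by
    have : 0 ≤ (s - 1) * μ.real A := mul_nonneg (by linarith) measureReal_nonneg
    linarith
  have hlim := ENNReal.tendsto_ofReal
    (hreal.div ((hreal.const_mul (s - 1)).const_add 1) hD)
  exact le_of_tendsto' hlim fun k ↦ strict (B k) (hBm k) (hBA k) (heq ▸ hBlt k)

end Capacity

/-! ### Lower integrals and integration over superlevel sets -/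

section MeasureTheory

variable {M : Type*} [MeasurableSpace M] {μ : Measure M}

/-- A measurable minorant with the same finite integral computes the integral of all products with
measurable functions. -/
theorem lintegral_mul_le_of_minorant {F ψ c : M → ℝ≥0∞} (hψ : Measurable ψ) (hle : ψ ≤ F)
    (heq : ∫⁻ x, F x ∂μ = ∫⁻ x, ψ x ∂μ) (hfin : ∫⁻ x, F x ∂μ ≠ ⊤) (hc : Measurable c)
    (hctop : ∀ x, c x ≠ ⊤) : ∫⁻ x, c x * F x ∂μ ≤ ∫⁻ x, c x * ψ x ∂μ := by
  obtain ⟨u, hu, hule, hueq⟩ := exists_measurable_le_lintegral_eq μ fun x ↦ c x * F x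
  -- Still a measurable minorant of F, so it cannot exceed ψ on a set of positive measure; hence u ≤
  -- c ψ almost everywhere.
  set v : M → ℝ≥0∞ := fun x ↦ max (ψ x) (u x / c x) with hv
  have hvm : Measurable v := hψ.max (hu.div hc)
  have hvF : v ≤ F := fun x ↦ max_le (hle x)
    (ENNReal.div_le_of_le_mul ((hule x).trans_eq (mul_comm _ _)))
  have hae : ψ =ᵐ[μ] v := ae_eq_of_ae_le_of_lintegral_le
    (Eventually.of_forall fun x ↦ le_max_left _ _) (heq ▸ hfin) hvm.aemeasurable
    (heq ▸ lintegral_mono hvF)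
  rw [hueq]
  refine lintegral_mono_ae ?_
  filter_upwards [hae] with x hx
  rw [hx]
  rcases eq_or_ne (c x) 0 with h0 | h0
  · simpa [h0] using hule x
  · calc u x = c x * (u x / c x) := (ENNReal.mul_div_cancel h0 (hctop x)).symm
      _ ≤ c x * v x := by gcongr; exact le_max_right _ _

/-- For τ > 0 the integral is 8τ² ∫_τ^∞ t⁻³ dt = 4. -/
theorem lintegral_cutoffWeight_le {τ : ℝ} (hτ : 0 ≤ τ) :
    ∫⁻ t in Ioi (0 : ℝ), ENNReal.ofReal (cutoffWeight t τ) * ENNReal.ofReal (2 * t) ≤ 4 := by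
  rcases hτ.eq_or_lt with rfl | hτ
  · simp [cutoffWeight]
  have hpt : ∀ t ∈ Ioi (0 : ℝ), ENNReal.ofReal (cutoffWeight t τ) * ENNReal.ofReal (2 * t) =
      (Ioi τ).indicator (fun t ↦ ENNReal.ofReal (8 * τ ^ 2 * t ^ (-3 : ℝ))) t := by
    intro t ht
    by_cases h : τ < t
    · have ht : 0 < t := ht
      rw [indicator_of_mem (show t ∈ Ioi τ from h), cutoffWeight, if_pos h,
        ← ENNReal.ofReal_mul (by positivity)]
      congr 1
      rw [Real.rpow_neg ht.le, show (3 : ℝ) = (3 : ℕ) by norm_num, Real.rpow_natCast]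
      field_simp
      norm_num
    · rw [indicator_of_notMem (show t ∉ Ioi τ from h), cutoffWeight, if_neg h]
      simp
  rw [setLIntegral_congr_fun measurableSet_Ioi hpt, setLIntegral_indicator measurableSet_Ioi,
    inter_eq_left.2 (Ioi_subset_Ioi hτ.le),
    ← ofReal_integral_eq_lintegral_ofReal
      ((integrableOn_Ioi_rpow_of_lt (by norm_num) hτ).const_mul _) ?_]
  · rw [integral_const_mul, integral_Ioi_rpow_of_lt (by norm_num) hτ,
      show (-3 : ℝ) + 1 = -(2 : ℕ) by norm_num, Real.rpow_neg hτ.le, Real.rpow_natCast]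
    rw [show (4 : ℝ≥0∞) = ENNReal.ofReal 4 by simp]
    apply ENNReal.ofReal_le_ofReal
    apply le_of_eq
    field_simp
    norm_num
  · filter_upwards [ae_restrict_mem measurableSet_Ioi] with t ht
    have : 0 < t := hτ.trans ht
    simp only [Pi.zero_apply]
    positivity

/-- Replaces the truncation by an upper bound affine in h, so that it can be integrated over A
knowing only ∫ h; p remains free for optimization. -/
theorem truncation_le {K p h I : ℝ} (hK : 0 ≤ K) (hh : 0 < h) (hI : 0 < I) :
    max 0 (1 - K * I / h) ≤ (1 - K * p) ^ 2 + K * p ^ 2 / I * h := by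
  refine max_le (by positivity) ?_
  have : (1 - K * p) ^ 2 + K * p ^ 2 / I * h - (1 - K * I / h) =
      (K * p) ^ 2 + K * (p * h - I) ^ 2 / (I * h) := by
    field_simp
    ring
  have h2 : 0 ≤ (K * p) ^ 2 + K * (p * h - I) ^ 2 / (I * h) := by positivity
  linarith

theorem withDensity_truncation_le [IsProbabilityMeasure μ] {h : M → ℝ}
    (h0 : ∀ x, 0 ≤ h x) (hint : Integrable h μ) (hI : 0 < ∫ x, h x ∂μ) {K : ℝ} (hK : 0 ≤ K)
    {A : Set M} (hA : MeasurableSet A) (hAh : ∀ x ∈ A, 0 < h x) :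
    μ.withDensity (fun x ↦ ENNReal.ofReal (max 0 (1 - K * (∫ x, h x ∂μ) / h x))) A ≤
      ENNReal.ofReal (μ.real A / (1 + K * μ.real A)) := by
  set I := ∫ x, h x ∂μ
  set a := μ.real A
  have ha : 0 ≤ a := measureReal_nonneg
  have hD : 0 < 1 + K * a := by positivity
  -- The minimizer of a(1 - Kp)² + Kp², with minimum a/(1 + Ka).
  set p := a / (1 + K * a)
  rw [withDensity_apply _ hA]
  have hi : Integrable (fun x ↦ (1 - K * p) ^ 2 + K * p ^ 2 / I * h x) (μ.restrict A) :=
    (integrable_const _).add ((hint.restrict).const_mul _)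
  calc ∫⁻ x in A, ENNReal.ofReal (max 0 (1 - K * I / h x)) ∂μ
      ≤ ∫⁻ x in A, ENNReal.ofReal ((1 - K * p) ^ 2 + K * p ^ 2 / I * h x) ∂μ :=
        setLIntegral_mono' hA fun x hx ↦
          ENNReal.ofReal_le_ofReal (truncation_le hK (hAh x hx) hI)
    _ = ENNReal.ofReal (∫ x in A, ((1 - K * p) ^ 2 + K * p ^ 2 / I * h x) ∂μ) := by
        rw [ofReal_integral_eq_lintegral_ofReal hi]
        exact Eventually.of_forall fun x ↦ by have := h0 x; simp only [Pi.zero_apply]; positivity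
    _ ≤ _ := by
        apply ENNReal.ofReal_le_ofReal
        rw [integral_add (integrable_const _) ((hint.restrict).const_mul _), integral_const_mul,
          setIntegral_const, smul_eq_mul]
        have hle : ∫ x in A, h x ∂μ ≤ I := setIntegral_le_integral hint (Eventually.of_forall h0)
        calc a * (1 - K * p) ^ 2 + K * p ^ 2 / I * ∫ x in A, h x ∂μ
            ≤ a * (1 - K * p) ^ 2 + K * p ^ 2 / I * I := by gcongr
          _ = a * (1 - K * p) ^ 2 + K * p ^ 2 := by field_simp
          _ = a / (1 + K * a) := by
            simp only [p]
            field_simp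
            ring

/-- Integration of the capacity-type lower bounds over the superlevel sets of `h`. -/
theorem lintegral_sq_le_of_superlevel [IsProbabilityMeasure μ] {h : M → ℝ} (hm : Measurable h)
    (h0 : ∀ x, 0 ≤ h x) (hint : Integrable h μ) {K : ℝ} (hK : 0 ≤ K) {F : M → ℝ≥0∞}
    (hF : ∫⁻ x, F x ∂μ ≠ ⊤) {D : ℝ≥0∞} (hD : D ≠ ⊤)
    (hlevel : ∀ t, 0 < t →
      ENNReal.ofReal (μ.real {x | t ≤ h x} / (1 + K * μ.real {x | t ≤ h x})) ≤
        D * ∫⁻ x, ENNReal.ofReal (cutoffWeight t (h x)) * F x ∂μ) :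
    ∫⁻ x, ENNReal.ofReal (h x ^ 2) ∂μ ≤
      ENNReal.ofReal (K * (∫ x, h x ∂μ) ^ 2) + D * 4 * ∫⁻ x, F x ∂μ := by
  have hInn : 0 ≤ ∫ x, h x ∂μ := integral_nonneg h0
  rcases hInn.eq_or_lt with hI0 | hI
  · have hae := (integral_eq_zero_iff_of_nonneg h0 hint).1 hI0.symm
    have : ∫⁻ x, ENNReal.ofReal (h x ^ 2) ∂μ = 0 := by
      rw [lintegral_eq_zero_iff (by fun_prop)]
      filter_upwards [hae] with x hx
      simp [hx]
    rw [this]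
    exact zero_le
  set I := ∫ x, h x ∂μ
  obtain ⟨ψ, hψ, hψF, hψeq⟩ := exists_measurable_le_lintegral_eq μ F
  -- Chosen so that h² ≤ K I h + g h², whose first term integrates to K I². Where h = 0, division by
  -- zero gives g = 1, harmless because h² = 0 there.
  set g : M → ℝ := fun x ↦ max 0 (1 - K * I / h x)
  have hg : Measurable g := by fun_prop
  have hg0 : ∀ x, 0 ≤ g x := fun x ↦ le_max_left _ _
  set ν := μ.withDensity fun x ↦ ENNReal.ofReal (g x)
  have hsplit : ∫⁻ x, ENNReal.ofReal (h x ^ 2) ∂μ ≤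
      ENNReal.ofReal (K * I ^ 2) + ∫⁻ x, ENNReal.ofReal (h x ^ 2) ∂ν := by
    have hpt : ∀ x, ENNReal.ofReal (h x ^ 2) ≤
        ENNReal.ofReal (K * I * h x) + ENNReal.ofReal (g x) * ENNReal.ofReal (h x ^ 2) := by
      intro x
      have hx := h0 x
      rw [← ENNReal.ofReal_mul (hg0 x), ← ENNReal.ofReal_add (by positivity)
        (mul_nonneg (hg0 x) (sq_nonneg _))]
      apply ENNReal.ofReal_le_ofReal
      rcases hx.eq_or_lt with hz | hz
      · simp [← hz]
      · calc h x ^ 2 = K * I * h x + (1 - K * I / h x) * h x ^ 2 := by field_simp; ring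
          _ ≤ _ := by gcongr; exact le_max_right _ _
    calc ∫⁻ x, ENNReal.ofReal (h x ^ 2) ∂μ ≤ _ := lintegral_mono hpt
      _ = _ := by
        rw [lintegral_add_left (by fun_prop), lintegral_withDensity_eq_lintegral_mul _
          (by fun_prop) (by fun_prop)]
        congr 1
        rw [← ofReal_integral_eq_lintegral_ofReal (hint.const_mul _)
          (Eventually.of_forall fun x ↦ mul_nonneg (by positivity) (h0 x)), integral_const_mul]
        congr 1
        ring
  refine hsplit.trans (add_le_add_right ?_ _)
  -- Layer cake formula for h² = ∫₀^h 2t dt.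
  have hcake : ∫⁻ x, ENNReal.ofReal (h x ^ 2) ∂ν =
      ∫⁻ t in Ioi (0 : ℝ), ν {x | t ≤ h x} * ENNReal.ofReal (2 * t) := by
    rw [← lintegral_comp_eq_lintegral_meas_le_mul ν (Eventually.of_forall h0) hm.aemeasurable
      (fun t _ ↦ (by fun_prop : Continuous fun t : ℝ ↦ 2 * t).intervalIntegrable 0 t)]
    · congr 1
      ext x
      rw [intervalIntegral.integral_const_mul, integral_id]
      congr 1
      ring
    · filter_upwards [ae_restrict_mem measurableSet_Ioi] with t ht
      have : 0 < t := ht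
      positivity
  rw [hcake]
  have hmeas : Measurable (Function.uncurry fun (t : ℝ) (x : M) ↦
      ENNReal.ofReal (cutoffWeight t (h x)) * ψ x * ENNReal.ofReal (2 * t)) := by
    have : Measurable fun q : ℝ × M ↦ cutoffWeight q.1 (h q.2) :=
      measurable_cutoffWeight.comp (measurable_fst.prodMk (hm.comp measurable_snd))
    unfold Function.uncurry
    fun_prop
  have hmeas' : ∀ t, Measurable fun x ↦ ENNReal.ofReal (cutoffWeight t (h x)) := fun t ↦
    (measurable_cutoffWeight.comp (measurable_const.prodMk hm)).ennreal_ofReal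
  calc ∫⁻ t in Ioi (0 : ℝ), ν {x | t ≤ h x} * ENNReal.ofReal (2 * t)
      ≤ ∫⁻ t in Ioi (0 : ℝ), D * ∫⁻ x, ENNReal.ofReal (cutoffWeight t (h x)) * ψ x *
          ENNReal.ofReal (2 * t) ∂μ := by
        refine setLIntegral_mono' measurableSet_Ioi fun t ht ↦ ?_
        have ht : 0 < t := ht
        have h1 : ν {x | t ≤ h x} ≤ _ := (withDensity_truncation_le h0 hint hI hK
          (measurableSet_le measurable_const hm) fun x hx ↦ ht.trans_le hx).trans (hlevel t ht)
        -- F may fail to be measurable; one minorant ψ serves all t, which allows the exchange of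
        -- integrals.
        have h2 := lintegral_mul_le_of_minorant hψ hψF hψeq hF (hmeas' t)
          fun x ↦ ENNReal.ofReal_ne_top
        have hp : Measurable fun x ↦ ENNReal.ofReal (cutoffWeight t (h x)) * ψ x :=
          (hmeas' t).mul hψ
        rw [lintegral_mul_const _ hp, ← mul_assoc]
        gcongr
        exact h1.trans (by gcongr)
    _ = D * ∫⁻ x, (∫⁻ t in Ioi (0 : ℝ), ENNReal.ofReal (cutoffWeight t (h x)) * ψ x *
          ENNReal.ofReal (2 * t)) ∂μ := by
        rw [lintegral_const_mul' _ _ hD, lintegral_lintegral_swap hmeas.aemeasurable]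
    _ ≤ D * ∫⁻ x, ψ x * 4 ∂μ := by
        gcongr with x
        simp_rw [mul_comm _ (ψ x), mul_assoc]
        have hmx : Measurable fun t ↦
            ENNReal.ofReal (cutoffWeight t (h x)) * ENNReal.ofReal (2 * t) := by
          have : Measurable fun t ↦ cutoffWeight t (h x) :=
            measurable_cutoffWeight.comp (measurable_id.prodMk measurable_const)
          fun_prop
        rw [lintegral_const_mul _ hmx]
        gcongr
        exact lintegral_cutoffWeight_le (h0 x)
    _ = D * 4 * ∫⁻ x, F x ∂μ := by
        rw [lintegral_mul_const _ hψ, hψeq]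
        ring

/-! ### Medians -/

/-- Existence of a median. -/
theorem exists_median [IsProbabilityMeasure μ] {f : M → ℝ} (hf : Measurable f)
    (h0 : ∀ x, 0 ≤ f x) {N : ℝ} (hN : ∀ x, f x ≤ N) :
    ∃ m, 0 ≤ m ∧ μ {x | m < f x} ≤ 1 / 2 ∧ μ {x | f x < m} ≤ 1 / 2 := by
  set S : Set ℝ := {t | 0 ≤ t ∧ μ {x | t < f x} ≤ 1 / 2}
  have hne : S.Nonempty := by
    refine ⟨max N 0, le_max_right _ _, ?_⟩
    have : {x | max N 0 < f x} = ∅ := by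
      ext x
      simpa using fun h : N < f x ↦ absurd h (hN x).not_gt
    rw [this]
    simp
  have hbdd : BddBelow S := ⟨0, fun t ht ↦ ht.1⟩
  have hd : ∀ k : ℕ, 0 < 1 / ((k : ℝ) + 1) := fun k ↦ Nat.one_div_pos_of_nat
  refine ⟨sInf S, le_csInf hne fun t ht ↦ ht.1, ?_, ?_⟩
  · have hmono : Monotone fun k : ℕ ↦ {x | sInf S + 1 / ((k : ℝ) + 1) < f x} :=
      fun i j hij x (hx : _ < f x) ↦
        (add_le_add_right (Nat.one_div_le_one_div hij) _).trans_lt hx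
    have hU : ⋃ k : ℕ, {x | sInf S + 1 / ((k : ℝ) + 1) < f x} = {x | sInf S < f x} := by
      ext x
      simp only [mem_iUnion, mem_ofPred_eq]
      constructor
      · rintro ⟨k, hk⟩
        linarith [hd k]
      · intro hx
        obtain ⟨k, hk⟩ := exists_nat_one_div_lt (sub_pos.2 hx)
        exact ⟨k, by linarith⟩
    have h := tendsto_measure_iUnion_atTop (μ := μ) hmono
    rw [hU] at h
    refine le_of_tendsto' h fun k ↦ ?_
    obtain ⟨t, ht, htk⟩ := exists_lt_of_csInf_lt hne (lt_add_of_pos_right (sInf S) (hd k))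
    exact (measure_mono fun x (hx : _ < f x) ↦ htk.trans hx).trans ht.2
  · have hmono : Monotone fun k : ℕ ↦ {x | f x ≤ sInf S - 1 / ((k : ℝ) + 1)} :=
      fun i j hij x (hx : f x ≤ _) ↦
        hx.trans (sub_le_sub_left (Nat.one_div_le_one_div hij) _)
    have hU : ⋃ k : ℕ, {x | f x ≤ sInf S - 1 / ((k : ℝ) + 1)} = {x | f x < sInf S} := by
      ext x
      simp only [mem_iUnion, mem_ofPred_eq]
      constructor
      · rintro ⟨k, hk⟩
        linarith [hd k]
      · intro hx
        obtain ⟨k, hk⟩ := exists_nat_one_div_lt (sub_pos.2 hx)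
        exact ⟨k, by linarith⟩
    have h := tendsto_measure_iUnion_atTop (μ := μ) hmono
    rw [hU] at h
    refine le_of_tendsto' h fun k ↦ ?_
    set t := sInf S - 1 / ((k : ℝ) + 1) with htdef
    change μ {x | f x ≤ t} ≤ 1 / 2
    rcases lt_or_ge t 0 with ht | ht
    · have : {x | f x ≤ t} = ∅ := by
        ext x
        simpa using ht.trans_le (h0 x)
      simp [this]
    · have hnot : t ∉ S := notMem_of_lt_csInf (by linarith [hd k]) hbdd
      have hlt : 1 / 2 < μ {x | t < f x} := not_le.1 fun hle ↦ hnot ⟨ht, hle⟩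
      have hc : {x | f x ≤ t} = {x | t < f x}ᶜ := by
        ext x
        simp
      rw [hc, prob_compl_eq_one_sub (measurableSet_lt measurable_const hf),
        tsub_le_iff_right]
      calc (1 : ℝ≥0∞) = 1 / 2 + 1 / 2 := (ENNReal.add_halves 1).symm
        _ ≤ _ := by gcongr

/-- The comparison of `∫ f² - s (∫ f)²` with the deviations from a median. -/
theorem integral_sq_le_of_median [IsProbabilityMeasure μ] {f : M → ℝ} (hf : Measurable f)
    (h0 : ∀ x, 0 ≤ f x) {N : ℝ} (hN : ∀ x, f x ≤ N) {m : ℝ} (hm0 : 0 ≤ m)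
    (hm : μ {x | f x < m} ≤ 1 / 2) {K : ℝ} (hK : 0 ≤ K) :
    ∫ x, f x ^ 2 ∂μ + K * (∫ x, max (f x - m) 0 ∂μ) ^ 2 + K * (∫ x, max (m - f x) 0 ∂μ) ^ 2 ≤
      (1 + K) * (∫ x, f x ∂μ) ^ 2 + ∫ x, max (f x - m) 0 ^ 2 ∂μ +
        ∫ x, max (m - f x) 0 ^ 2 ∂μ := by
  have hbd : ∀ {u : M → ℝ}, Measurable u → (∃ C, ∀ x, |u x| ≤ C) → Integrable u μ :=
    fun hu ⟨C, hC⟩ ↦ Integrable.of_bound hu.aestronglyMeasurable C (Eventually.of_forall hC)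
  have hfN : ∀ x, |f x| ≤ |N| := fun x ↦ by
    rw [abs_of_nonneg (h0 x)]; exact (hN x).trans (le_abs_self N)
  have hpb : ∀ x, |max (f x - m) 0| ≤ |N| + m := fun x ↦ by
    have := abs_le.1 (hfN x)
    rw [abs_of_nonneg (le_max_right _ _)]
    exact max_le (by linarith) (by linarith)
  have hqb : ∀ x, |max (m - f x) 0| ≤ m := fun x ↦ by
    rw [abs_of_nonneg (le_max_right _ _)]
    exact max_le (by linarith [h0 x]) hm0
  have hsq : ∀ {u : M → ℝ} {C : ℝ}, (∀ x, |u x| ≤ C) → ∀ x, |u x ^ 2| ≤ C ^ 2 :=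
    fun hu x ↦ by rw [abs_pow]; exact pow_le_pow_left₀ (abs_nonneg _) (hu x) 2
  have if1 : Integrable f μ := hbd hf ⟨_, hfN⟩
  have if2 : Integrable (fun x ↦ f x ^ 2) μ := hbd (by fun_prop) ⟨_, hsq hfN⟩
  have ip1 : Integrable (fun x ↦ max (f x - m) 0) μ := hbd (by fun_prop) ⟨_, hpb⟩
  have ip2 : Integrable (fun x ↦ max (f x - m) 0 ^ 2) μ := hbd (by fun_prop) ⟨_, hsq hpb⟩
  have iq1 : Integrable (fun x ↦ max (m - f x) 0) μ := hbd (by fun_prop) ⟨_, hqb⟩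
  have iq2 : Integrable (fun x ↦ max (m - f x) 0 ^ 2) μ := hbd (by fun_prop) ⟨_, hsq hqb⟩
  have hB : MeasurableSet {x | f x < m} := measurableSet_lt hf measurable_const
  have hmr : μ.real {x | f x < m} ≤ 1 / 2 := by
    have := ENNReal.toReal_mono (by simp) hm
    simpa [Measure.real] using this
  -- the mean absolute deviation from the median is at most the mean
  have hdev : ∫ x, max (f x - m) 0 ∂μ + ∫ x, max (m - f x) 0 ∂μ ≤ ∫ x, f x ∂μ := by
    have hind : Integrable ({x | f x < m}.indicator fun _ ↦ 2 * m) μ :=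
      (integrable_const _).indicator hB
    -- Since μ(f < m) ≤ 1/2 and m ≥ 0, the correction 2m·1_{f<m} - m has nonpositive integral.
    have hpt : ∀ x, max (f x - m) 0 + max (m - f x) 0 ≤
        f x + ({x | f x < m}.indicator (fun _ ↦ 2 * m) x - m) := by
      intro x
      have := h0 x
      rcases lt_or_ge (f x) m with h | h
      · rw [indicator_of_mem (show x ∈ {x | f x < m} from h), max_eq_right (by linarith),
          max_eq_left (by linarith)]
        linarith
      · rw [indicator_of_notMem (show x ∉ {x | f x < m} from h.not_gt), max_eq_left (by linarith),
          max_eq_right (by linarith)]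
        linarith
    have hind' : Integrable (fun x ↦ {x | f x < m}.indicator (fun _ ↦ 2 * m) x - m) μ :=
      hind.sub (integrable_const m)
    have h1 := integral_mono (ip1.add iq1) (if1.add hind') hpt
    simp only [Pi.add_apply] at h1
    rw [integral_add ip1 iq1, integral_add if1 hind',
      integral_sub hind (integrable_const m), integral_indicator_const _ hB, integral_const] at h1
    simp only [probReal_univ, smul_eq_mul, one_mul] at h1
    nlinarith
  have hp0 : 0 ≤ ∫ x, max (f x - m) 0 ∂μ := integral_nonneg fun x ↦ le_max_right _ _
  have hq0 : 0 ≤ ∫ x, max (m - f x) 0 ∂μ := integral_nonneg fun x ↦ le_max_right _ _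
  have hsum : ∫ x, max (f x - m) 0 ^ 2 ∂μ + ∫ x, max (m - f x) 0 ^ 2 ∂μ =
      ∫ x, f x ^ 2 ∂μ - 2 * m * ∫ x, f x ∂μ + m ^ 2 := by
    rw [← integral_add ip2 iq2]
    have hpt : ∀ x, max (f x - m) 0 ^ 2 + max (m - f x) 0 ^ 2 =
        f x ^ 2 - 2 * m * f x + m ^ 2 := by
      intro x
      rcases le_total (f x) m with h | h
      · rw [max_eq_right (by linarith), max_eq_left (by linarith)]
        ring
      · rw [max_eq_left (by linarith), max_eq_right (by linarith)]
        ring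
    simp_rw [hpt]
    have hi : Integrable (fun x ↦ f x ^ 2 - 2 * m * f x) μ := if2.sub (if1.const_mul _)
    rw [integral_add hi (integrable_const _), integral_sub if2 (if1.const_mul _), integral_const_mul, integral_const]
    simp
  set J := ∫ x, f x ∂μ
  set P := ∫ x, max (f x - m) 0 ∂μ
  set Q := ∫ x, max (m - f x) 0 ∂μ
  have hPQ : P ^ 2 + Q ^ 2 ≤ J ^ 2 := by nlinarith [mul_nonneg hp0 hq0]
  -- By `hsum` the second moments differ by 2mJ - m², which is at most J²: this is the extra unit in
  -- 1 + K.
  nlinarith [mul_le_mul_of_nonneg_left hPQ hK, sq_nonneg (J - m)]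

end MeasureTheory

theorem locallyLipschitz_comp {M : Type*} [EMetricSpace M] {f : M → ℝ} (hf : LocallyLipschitz f)
    {φ : ℝ → ℝ} (hφ : LocallyLipschitz φ) : LocallyLipschitz fun x ↦ φ (f x) := hφ.comp hf

/-! ### The super-Poincaré inequality -/

section Main

variable (n : ℕ) {M : Type*} [EMetricSpace M] [ChartedSpace (EuclideanSpace ℝ (Fin n)) M]
  [RiemannianBundle (fun x : M ↦ TangentSpace (𝓡 n) x)] [MeasurableSpace M]

theorem energy_posPart_add_negPart_le {μ : Measure M} {f : M → ℝ} (hf : Continuous f) (m : ℝ) :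
    energy n μ (fun y ↦ max (f y - m) 0) + energy n μ (fun y ↦ max (m - f y) 0) ≤
      energy n μ f :=
  -- Lower integrals are superadditive without any measurability.
  (le_lintegral_add _ _).trans
    (lintegral_mono fun x ↦ enorm_gradient_posPart_add_negPart_le n hf m x)

theorem energy_min_abs_le {μ : Measure M} {f : M → ℝ} (hf : Continuous f) {N : ℝ} (hN : 0 < N) :
    energy n μ (fun y ↦ min |f y| N) ≤ energy n μ f :=
  lintegral_mono fun x ↦ by
    have := enorm_gradient_min_abs_le n hf hN x
    gcongr

variable [BorelSpace M] [SecondCountableTopology M] {μ : Measure M} [IsProbabilityMeasure μ]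
  [NullSingletonClass μ] {β : ℝ → ℝ}

/-- The constant 8 is 2 from the rate comparison times 4 from the cut-off integral. -/
theorem superPoincare_of_small_support (hβ_pos : ∀ s, 1 ≤ s → 0 < β s)
    (hβ_anti : AntitoneOn β (Ici 1)) (hβ_mono : MonotoneOn (fun s ↦ s * β s) (Ici 2))
    (hcap : ∀ A : Set M, MeasurableSet A → μ A < 1 / 2 →
      ENNReal.ofReal (μ.real A / β (1 / μ.real A)) ≤ capacity n μ A)
    {h : M → ℝ} (hL : LocallyLipschitz h) (h0 : ∀ x, 0 ≤ h x) {C : ℝ} (hC : ∀ x, h x ≤ C)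
    (hsupp : μ {x | 0 < h x} ≤ 1 / 2) (hfin : energy n μ h ≠ ⊤) {s : ℝ} (hs : 1 ≤ s) :
    ∫⁻ x, ENNReal.ofReal (h x ^ 2) ∂μ ≤
      ENNReal.ofReal ((s - 1) * (∫ x, h x ∂μ) ^ 2) +
        ENNReal.ofReal (8 * β s) * energy n μ h := by
  have hc := hL.continuous
  have hint : Integrable h μ := Integrable.of_bound hc.aestronglyMeasurable C
    (Eventually.of_forall fun x ↦ by rw [Real.norm_of_nonneg (h0 x)]; exact hC x)
  have hD : ENNReal.ofReal (8 * β s) = ENNReal.ofReal (2 * β s) * 4 := by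
    rw [show (4 : ℝ≥0∞) = ENNReal.ofReal 4 by simp, ← ENNReal.ofReal_mul' (by norm_num)]
    ring_nf
  rw [hD]
  refine lintegral_sq_le_of_superlevel hc.measurable h0 hint (by linarith) hfin
    ENNReal.ofReal_ne_top fun t ht ↦ ?_
  have hu : LocallyLipschitz fun x ↦ min ((h x / t) ^ 2) 1 :=
    (locallyLipschitz_comp hL (φ := fun τ ↦ (τ / t) ^ 2)
      (ContDiff.locallyLipschitz (𝕂 := ℝ) (by fun_prop))).min_const 1
  refine (measure_le_energy_of_capacity n hβ_pos hβ_anti hβ_mono hcap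
    (measurableSet_le measurable_const hc.measurable)
    (measurableSet_lt measurable_const hc.measurable)
    (fun x hx ↦ ht.trans_le hx) hsupp hu (fun x hx ↦ ?_) (fun x hx ↦ ?_) hs).trans ?_
  · exact le_min (one_le_pow₀ ((one_le_div ht).2 hx)) le_rfl
  · have : h x = 0 := le_antisymm (not_lt.1 hx) (h0 x)
    simp [this]
  · gcongr
    exact lintegral_mono fun x ↦ enorm_gradient_cutoff_le n hc h0 ht x

theorem superPoincare_of_bounded (hβ_pos : ∀ s, 1 ≤ s → 0 < β s)
    (hβ_anti : AntitoneOn β (Ici 1)) (hβ_mono : MonotoneOn (fun s ↦ s * β s) (Ici 2))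
    (hcap : ∀ A : Set M, MeasurableSet A → μ A < 1 / 2 →
      ENNReal.ofReal (μ.real A / β (1 / μ.real A)) ≤ capacity n μ A)
    {f : M → ℝ} (hL : LocallyLipschitz f) (h0 : ∀ x, 0 ≤ f x) {N : ℝ} (hN : ∀ x, f x ≤ N)
    {s : ℝ} (hs : 1 ≤ s) :
    ∫⁻ x, ENNReal.ofReal (f x ^ 2) ∂μ ≤
      ENNReal.ofReal (s * (∫ x, f x ∂μ) ^ 2) + ENNReal.ofReal (8 * β s) * energy n μ f := by
  have hβs := hβ_pos s hs
  rcases eq_or_ne (energy n μ f) ⊤ with htop | hfin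
  · rw [htop, ENNReal.mul_top (by simpa using hβs)]
    simp
  have hc := hL.continuous
  obtain ⟨m, hm0, hm1, hm2⟩ := exists_median (μ := μ) hc.measurable h0 hN
  have hE := energy_posPart_add_negPart_le n (μ := μ) hc m
  have hLp : LocallyLipschitz fun x ↦ max (f x - m) 0 :=
    (locallyLipschitz_comp hL (φ := fun τ ↦ τ - m)
      (ContDiff.locallyLipschitz (𝕂 := ℝ) (by fun_prop))).max_const 0
  have hLq : LocallyLipschitz fun x ↦ max (m - f x) 0 :=
    (locallyLipschitz_comp hL (φ := fun τ ↦ m - τ)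
      (ContDiff.locallyLipschitz (𝕂 := ℝ) (by fun_prop))).max_const 0
  have hpC : ∀ x, max (f x - m) 0 ≤ max (N - m) 0 := fun x ↦
    max_le_max_right _ (by linarith [hN x])
  have hqC : ∀ x, max (m - f x) 0 ≤ m := fun x ↦ max_le (by linarith [h0 x]) hm0
  have hp := superPoincare_of_small_support n hβ_pos hβ_anti hβ_mono hcap hLp
    (fun x ↦ le_max_right _ _) hpC (by simpa using hm1)
    (ne_top_of_le_ne_top hfin (le_self_add.trans hE)) hs
  have hq := superPoincare_of_small_support n hβ_pos hβ_anti hβ_mono hcap hLq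
    (fun x ↦ le_max_right _ _) hqC (by simpa using hm2)
    (ne_top_of_le_ne_top hfin (le_add_self.trans hE)) hs
  have hreal := integral_sq_le_of_median hc.measurable h0 hN hm0 hm2 (K := s - 1) (by linarith)
  have hsqi : ∀ {u : M → ℝ} {C : ℝ}, Measurable u → (∀ x, 0 ≤ u x) → (∀ x, u x ≤ C) →
      ENNReal.ofReal (∫ x, u x ^ 2 ∂μ) = ∫⁻ x, ENNReal.ofReal (u x ^ 2) ∂μ := by
    intro u C hu hu0 huC
    refine ofReal_integral_eq_lintegral_ofReal (Integrable.of_bound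
      (hu.pow_const 2).aestronglyMeasurable (C ^ 2) (Eventually.of_forall fun x ↦ ?_))
      (Eventually.of_forall fun x ↦ sq_nonneg _)
    rw [Real.norm_of_nonneg (sq_nonneg _)]
    exact pow_le_pow_left₀ (hu0 x) (huC x) 2
  rw [← hsqi hLp.continuous.measurable (fun x ↦ le_max_right _ _) hpC] at hp
  rw [← hsqi hLq.continuous.measurable (fun x ↦ le_max_right _ _) hqC] at hq
  rw [← hsqi hc.measurable h0 hN]
  set b := ENNReal.ofReal (8 * β s)
  set e₁ := energy n μ fun y ↦ max (f y - m) 0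
  set e₂ := energy n μ fun y ↦ max (m - f y) 0
  set P := ∫ x, max (f x - m) 0 ∂μ
  set Q := ∫ x, max (m - f x) 0 ∂μ
  set P₂ := ∫ x, max (f x - m) 0 ^ 2 ∂μ
  set Q₂ := ∫ x, max (m - f x) 0 ^ 2 ∂μ
  have hP₂ : 0 ≤ P₂ := integral_nonneg fun x ↦ sq_nonneg _
  have hQ₂ : 0 ≤ Q₂ := integral_nonneg fun x ↦ sq_nonneg _
  have hF₂ : 0 ≤ ∫ x, f x ^ 2 ∂μ := integral_nonneg fun x ↦ sq_nonneg _
  have hK : 0 ≤ s - 1 := by linarith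
  have hs0 : 0 ≤ s := by linarith
  -- These finite terms are added to both sides to avoid truncated subtraction.
  have hcancel : ENNReal.ofReal ((s - 1) * P ^ 2) + ENNReal.ofReal ((s - 1) * Q ^ 2) ≠ ⊤ := by simp
  rw [← ENNReal.add_le_add_iff_right hcancel]
  calc ENNReal.ofReal (∫ x, f x ^ 2 ∂μ) +
        (ENNReal.ofReal ((s - 1) * P ^ 2) + ENNReal.ofReal ((s - 1) * Q ^ 2))
      ≤ ENNReal.ofReal (s * (∫ x, f x ∂μ) ^ 2) + (ENNReal.ofReal P₂ + ENNReal.ofReal Q₂) := by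
        rw [← ENNReal.ofReal_add (by positivity) (by positivity),
          ← ENNReal.ofReal_add hF₂ (by positivity), ← ENNReal.ofReal_add hP₂ hQ₂,
          ← ENNReal.ofReal_add (by positivity) (by positivity)]
        apply ENNReal.ofReal_le_ofReal
        linarith
    _ ≤ ENNReal.ofReal (s * (∫ x, f x ∂μ) ^ 2) +
        ((ENNReal.ofReal ((s - 1) * P ^ 2) + b * e₁) +
          (ENNReal.ofReal ((s - 1) * Q ^ 2) + b * e₂)) := by gcongr
    _ = ENNReal.ofReal (s * (∫ x, f x ∂μ) ^ 2) + b * (e₁ + e₂) +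
        (ENNReal.ofReal ((s - 1) * P ^ 2) + ENNReal.ofReal ((s - 1) * Q ^ 2)) := by ring
    _ ≤ _ := by gcongr

theorem superPoincare_of_capacity (hβ_pos : ∀ s, 1 ≤ s → 0 < β s)
    (hβ_anti : AntitoneOn β (Ici 1)) (hβ_mono : MonotoneOn (fun s ↦ s * β s) (Ici 2))
    (hcap : ∀ A : Set M, MeasurableSet A → μ A < 1 / 2 →
      ENNReal.ofReal (μ.real A / β (1 / μ.real A)) ≤ capacity n μ A)
    {f : M → ℝ} (hL : LocallyLipschitz f) {s : ℝ} (hs : 1 ≤ s) :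
    ∫⁻ x, ‖f x‖ₑ ^ 2 ∂μ ≤
      ENNReal.ofReal s * (∫⁻ x, ‖f x‖ₑ ∂μ) ^ 2 + ENNReal.ofReal (8 * β s) * energy n μ f := by
  have hc := hL.continuous
  have hN : ∀ k : ℕ, (0 : ℝ) < k + 1 := fun k ↦ by positivity
  set u : ℕ → M → ℝ := fun k x ↦ min |f x| (k + 1)
  have hu0 : ∀ k x, 0 ≤ u k x := fun k x ↦ le_min (abs_nonneg _) (hN k).le
  have huN : ∀ k x, u k x ≤ k + 1 := fun k x ↦ min_le_right _ _
  have huL : ∀ k, LocallyLipschitz (u k) := fun k ↦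
    (locallyLipschitz_comp hL (φ := fun τ ↦ |τ|) lipschitzWith_one_norm.locallyLipschitz).min_const _
  have habs : ∀ x, ‖f x‖ₑ = ENNReal.ofReal |f x| := fun x ↦ Real.enorm_eq_ofReal_abs _
  have hlim : Tendsto (fun k ↦ ∫⁻ x, ENNReal.ofReal (u k x ^ 2) ∂μ) atTop
      (𝓝 (∫⁻ x, ‖f x‖ₑ ^ 2 ∂μ)) := by
    refine lintegral_tendsto_of_tendsto_of_monotone
      (fun k ↦ ((huL k).continuous.measurable.pow_const 2).ennreal_ofReal.aemeasurable)
      (Eventually.of_forall fun x i j hij ↦ ?_) (Eventually.of_forall fun x ↦ ?_)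
    · apply ENNReal.ofReal_le_ofReal
      have : u i x ≤ u j x := min_le_min_left _ (by gcongr)
      exact pow_le_pow_left₀ (hu0 i x) this 2
    · refine tendsto_const_nhds.congr' ?_
      filter_upwards [eventually_ge_atTop ⌈|f x|⌉₊] with k hk
      have h1 : |f x| ≤ k + 1 := (Nat.ceil_le.1 hk).trans (by linarith)
      simp only [u, min_eq_left h1]
      rw [habs, ENNReal.ofReal_pow (abs_nonneg _)]
  refine le_of_tendsto' hlim fun k ↦ ?_
  refine (superPoincare_of_bounded n hβ_pos hβ_anti hβ_mono hcap (huL k) (hu0 k) (huN k)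
    hs).trans ?_
  gcongr
  · rw [ENNReal.ofReal_mul (by linarith), ENNReal.ofReal_pow (integral_nonneg (hu0 k))]
    gcongr
    rw [ofReal_integral_eq_lintegral_ofReal (Integrable.of_bound
      (huL k).continuous.aestronglyMeasurable ((k : ℝ) + 1) (Eventually.of_forall fun x ↦ by
        rw [Real.norm_of_nonneg (hu0 k x)]; exact huN k x)) (Eventually.of_forall (hu0 k))]
    refine lintegral_mono fun x ↦ ?_
    rw [habs]
    exact ENNReal.ofReal_le_ofReal (min_le_left _ _)
  · exact energy_min_abs_le n hc (hN k)

end Main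

end SuperPoincare

theorem mainTheorem9 {n : ℕ} (hn : 1 ≤ n) {M : Type*} [EMetricSpace M]
    [ChartedSpace (EuclideanSpace ℝ (Fin n)) M] [IsManifold (𝓡 n) ∞ M]
    [RiemannianBundle (fun x : M ↦ TangentSpace (𝓡 n) x)]
    [IsContMDiffRiemannianBundle (𝓡 n) ∞ (EuclideanSpace ℝ (Fin n))
      (fun x : M ↦ TangentSpace (𝓡 n) x)]
    [IsRiemannianManifold (𝓡 n) M] [SecondCountableTopology M]
    [MeasurableSpace M] [BorelSpace M]
    (μ : Measure M) [IsProbabilityMeasure μ] (hμ : μ ≪ SuperPoincare.riemannianVolume n)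
    (β : ℝ → ℝ) (hβ_pos : ∀ s, 1 ≤ s → 0 < β s) (hβ_anti : AntitoneOn β (Set.Ici 1))
    (hβ_mono : MonotoneOn (fun s ↦ s * β s) (Set.Ici 2)) :
    (∀ a : ℝ, 0 < a → a < 1 / 2 →
      BddAbove (Set.range fun s : Set.Ici (1 : ℝ) ↦ a / (1 + ((s : ℝ) - 1) * a) * (1 / β s)) ∧
      1 / 2 * (a / β (1 / a)) ≤
        (⨆ s : Set.Ici (1 : ℝ), a / (1 + ((s : ℝ) - 1) * a) * (1 / β s)) ∧
      (⨆ s : Set.Ici (1 : ℝ), a / (1 + ((s : ℝ) - 1) * a) * (1 / β s)) ≤ 2 * (a / β (1 / a))) ∧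
    ((∀ A : Set M, MeasurableSet A → μ A < 1 / 2 →
        ENNReal.ofReal (μ.real A / β (1 / μ.real A)) ≤ SuperPoincare.capacity n μ A) →
      ∀ f : M → ℝ, LocallyLipschitz f → ∀ s : ℝ, 1 ≤ s →
        ∫⁻ x, ‖f x‖ₑ ^ 2 ∂μ ≤
          ENNReal.ofReal s * (∫⁻ x, ‖f x‖ₑ ∂μ) ^ 2 +
            ENNReal.ofReal (8 * β s) * SuperPoincare.energy n μ f) := by
  constructor
  · intro a ha ha2
    have hle : ∀ s : Set.Ici (1 : ℝ),
        a / (1 + ((s : ℝ) - 1) * a) * (1 / β s) ≤ 2 * (a / β (1 / a)) := fun s ↦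
      SuperPoincare.rate_le_two_mul hβ_pos hβ_anti hβ_mono ha ha2 s.2
    have hbdd : BddAbove (Set.range fun s : Set.Ici (1 : ℝ) ↦
        a / (1 + ((s : ℝ) - 1) * a) * (1 / β s)) := ⟨_, Set.forall_mem_range.2 hle⟩
    have h1 : 1 ≤ 1 / a := by rw [le_div_iff₀ ha]; linarith
    have hb := hβ_pos _ h1
    have : Nonempty (Set.Ici (1 : ℝ)) := ⟨⟨1, by simp⟩⟩
    -- At s = 1/a the denominator is 2 - a ≤ 2, which gives the lower bound.
    refine ⟨hbdd, le_trans ?_ (le_ciSup hbdd ⟨1 / a, h1⟩), ciSup_le hle⟩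
    have h2 : 1 + (1 / a - 1) * a = 2 - a := by field_simp; ring
    simp only [h2]
    rw [div_mul_div_comm, div_mul_div_comm]
    exact div_le_div₀ (by linarith) (by linarith) (by nlinarith) (by nlinarith)
  · intro hcap f hf s hs
    have : NullSingletonClass μ :=
      ⟨fun x ↦ hμ (SuperPoincare.riemannianVolume_singleton n hn x)⟩
    exact SuperPoincare.superPoincare_of_capacity n hβ_pos hβ_anti hβ_mono hcap hf hs
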